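/- For an indeterminate $q$ put $(a;q)_k=\prod_{i=0}^{k-1}(1-aq^i)$ and $[m]=(1-q^m)/(1-q)$ for $m\in\mathbb Z$, let $\Phi_n(q)$ be the $n$-th cyclotomic polynomial, and for a rational function $A(q)\in\mathbb Q(q)$ and a polynomial $P(q)\in\mathbb Q[q]$ write $A(q)\equiv 0\pmod{P(q)}$ if $P(q)$ divides the numerator of $A(q)$ written in lowest terms. Let $d\geqslant 3$ be an odd integer and let $n>1$ be an integer. Then $$\sum_{k=0}^{n-1}[2dk-1]\,\frac{(q^{-1};q^d)_k^d}{(q^d;q^d)_k^d}\,q^{\frac{d(d-1)k}{2}}\equiv\begin{cases}0\pmod{\Phi_n(q)^2}, & \text{if } n\equiv 1\pmod d,\\ 0\pmod{\Phi_n(q)^3}, & \text{if } n\equiv \tfrac12\pmod d,\end{cases}$$ where $n\equiv\frac12\pmod d$ means $2n\equiv 1\pmod d$. -/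

import Mathlib

/-- The `q`-shifted factorial `(a; q)_k = (1 - a) (1 - a q) ⋯ (1 - a q ^ (k - 1))`. -/
def qPoch {K : Type*} [Field K] (a q : K) (k : ℕ) : K :=
  ∏ i ∈ Finset.range k, (1 - a * q ^ i)

/-- The `q`-integer `[m] = (1 - q ^ m) / (1 - q)`, for every integer `m`, as a rational function
of the indeterminate `q = RatFunc.X`. For `m ≥ 0` this is `1 + q + ⋯ + q ^ (m - 1)`. -/
noncomputable def qInt (m : ℤ) : RatFunc ℚ :=
  (1 - RatFunc.X ^ m) / (1 - RatFunc.X)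

/-- Congruence of rational functions modulo a polynomial: `A ≡ B (mod P)` when `P` divides the
numerator of `A - B`, written in lowest terms. -/
def RatCongr (P : Polynomial ℚ) (A B : RatFunc ℚ) : Prop :=
  P ∣ (A - B).num

/-- The truncated basic hypergeometric sum
`∑_{k=0}^{n-1} [2dk-1] (q⁻¹; q^d)_k^d / (q^d; q^d)_k^d * q^(d(d-1)k/2)`.
The product `d * (d - 1)` is even, so the division in the exponent is exact. -/
noncomputable def truncSum (d n : ℕ) : RatFunc ℚ :=
  ∑ k ∈ Finset.range n,
    qInt (2 * (d : ℤ) * (k : ℤ) - 1) *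
      (qPoch (RatFunc.X : RatFunc ℚ)⁻¹ (RatFunc.X ^ d) k ^ d /
        qPoch (RatFunc.X ^ d : RatFunc ℚ) (RatFunc.X ^ d) k ^ d) *
      RatFunc.X ^ (d * (d - 1) * k / 2)

/-! Put d = 2h + 3 and Q = q^d, and clear denominators: the cleared denominator is prime to Φₙ
because n is coprime to d, so everything reduces to powers of Φₙ dividing the polynomial F =
`truncNum`.

Deform F to N(x): among d equal factors, one takes x^(∓r) and r others take x^(±1). First-order
effects cancel, so after clearing powers of x, N(x) ≡ F x^k mod (x - 1)². At x = qⁿ the factor q x^r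
becomes a power of Q, so the sum terminates; it is then a divided difference of a polynomial of too
low degree, hence 0. Thus (qⁿ - 1)² divides F q^(nk), and Φₙ² divides F.

For n ≡ 1 take r = d - 1, deform the essential numerators only, and interpolate at the nodes Q^k
(`wellPoisedSum_numFactor_eq_zero`). For 2n ≡ 1 take r = d - 2, deform the denominators too, and use
the nodes Q^k + q/Q^k (`wellPoisedSum_numFactor'_eq_zero`). In this case N also vanishes identically
in x at a primitive n-th root of unity, by pairing k with M - k. Hence Φₙ divides the quotient of N
- F x^k by (x - 1)², which gives the third factor. -/

open Finset

/-- The very-well-poised sum `∑_{k ≤ L} (q - Q^{2k}) Q^{hk} ∏_{i<k} ν i / δ i`, multiplied by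
`∏_{i<L} δ i`. -/
def wellPoisedSum {R : Type*} [CommRing R] (h L : ℕ) (q Q : R) (ν δ : ℕ → R) : R :=
  ∑ k ∈ range (L + 1),
    (q - Q ^ (2 * k)) * Q ^ (h * k) * ((∏ i ∈ range k, ν i) * ∏ i ∈ Ico k L, δ i)

/-- `q ^ (r + 1) (1 - x⁻ʳ Qⁱ / q) (1 - x Qⁱ / q) ^ r`, multiplied by `x ^ r`. -/
def numFactor {R : Type*} [CommRing R] (r : ℕ) (q Q x : R) (i : ℕ) : R :=
  (q * x ^ r - Q ^ i) * (q - Q ^ i * x) ^ r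

/-- `q ^ (r + 1) (1 - Q ^ (i + 1)) ^ (r + 1)`, multiplied by `x ^ r`. -/
def denFactor {R : Type*} [CommRing R] (r : ℕ) (q Q x : R) (i : ℕ) : R :=
  q ^ (r + 1) * x ^ r * (1 - Q ^ (i + 1)) ^ (r + 1)

/-- The numerator factor of the two-sided deformation. -/
def numFactor' {R : Type*} [CommRing R] (r : ℕ) (q Q x : R) (i : ℕ) : R :=
  (q - Q ^ i) * ((q * x ^ r - Q ^ i) * (q - Q ^ i * x) ^ r)

/-- The denominator factor of the two-sided deformation. -/
def denFactor' {R : Type*} [CommRing R] (r : ℕ) (q Q x : R) (i : ℕ) : R :=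
  q ^ (r + 2) * (1 - Q ^ (i + 1)) * ((1 - Q ^ (i + 1) * x ^ r) * (x - Q ^ (i + 1)) ^ r)

/-! ### Specialisation, truncation and first-order expansion of the sums -/

section General

variable {R S : Type*} [CommRing R] [CommRing S]

theorem map_wellPoisedSum (f : R →+* S) (h L : ℕ) (q Q : R) (ν δ : ℕ → R) :
    f (wellPoisedSum h L q Q ν δ) =
      wellPoisedSum h L (f q) (f Q) (fun i ↦ f (ν i)) (fun i ↦ f (δ i)) := by
  simp [wellPoisedSum, map_sum, map_prod]

theorem map_numFactor (f : R →+* S) (r : ℕ) (q Q x : R) (i : ℕ) :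
    f (numFactor r q Q x i) = numFactor r (f q) (f Q) (f x) i := by
  simp [numFactor]

theorem map_denFactor (f : R →+* S) (r : ℕ) (q Q x : R) (i : ℕ) :
    f (denFactor r q Q x i) = denFactor r (f q) (f Q) (f x) i := by
  simp [denFactor]

theorem map_numFactor' (f : R →+* S) (r : ℕ) (q Q x : R) (i : ℕ) :
    f (numFactor' r q Q x i) = numFactor' r (f q) (f Q) (f x) i := by
  simp [numFactor']

theorem map_denFactor' (f : R →+* S) (r : ℕ) (q Q x : R) (i : ℕ) :
    f (denFactor' r q Q x i) = denFactor' r (f q) (f Q) (f x) i := by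
  simp [denFactor']

theorem wellPoisedSum_of_num_eq_zero (h : ℕ) {L M : ℕ} (hML : M ≤ L) (q Q : R) (ν δ : ℕ → R)
    (hν : ν M = 0) :
    wellPoisedSum h L q Q ν δ = wellPoisedSum h M q Q ν δ * ∏ i ∈ Ico M L, δ i := by
  unfold wellPoisedSum
  rw [sum_mul]
  symm
  rw [← sum_subset (range_subset_range.2 (Nat.succ_le_succ hML))]
  · refine sum_congr rfl fun k hk ↦ ?_
    rw [← prod_Ico_consecutive δ (Nat.lt_succ_iff.1 (mem_range.1 hk)) hML]
    ring
  · intro k _ hk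
    have hMk : M ∈ range k := by simp at hk ⊢; omega
    rw [prod_eq_zero hMk hν]
    ring

/-- Every term has k factors ν and L - k factors δ, so c comes out exactly L times whatever k is. -/
theorem dvd_wellPoisedSum_sub (h L : ℕ) (q Q s c : R) (ν δ ν' δ' : ℕ → R)
    (hν : ∀ i, s ∣ ν i - ν' i * c) (hδ : ∀ i, s ∣ δ i - δ' i * c) :
    s ∣ wellPoisedSum h L q Q ν δ - wellPoisedSum h L q Q ν' δ' * c ^ L := by
  rw [← Ideal.mem_span_singleton, ← Ideal.Quotient.eq_zero_iff_mem, map_sub, sub_eq_zero,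
    map_mul, map_wellPoisedSum, map_wellPoisedSum]
  have key : ∀ u v : R, s ∣ u - v * c → Ideal.Quotient.mk (Ideal.span {s}) u =
      Ideal.Quotient.mk (Ideal.span {s}) v * Ideal.Quotient.mk (Ideal.span {s}) c := by
    intro u v huv
    rw [← map_mul, ← sub_eq_zero, ← map_sub, Ideal.Quotient.eq_zero_iff_mem,
      Ideal.mem_span_singleton]
    exact huv
  simp only [key _ _ (hν _), key _ _ (hδ _), map_pow]
  unfold wellPoisedSum
  rw [sum_mul]
  refine sum_congr rfl fun k hk ↦ ?_
  have hk' : k + (L - k) = L := by have := mem_range.1 hk; omega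
  rw [prod_mul_distrib, prod_mul_distrib, prod_const, prod_const, Nat.card_Ico, card_range]
  conv_rhs => rw [← hk', pow_add]
  rw [hk']
  ring

/-- First-order expansion at `x = 1` of the product of two mirrored factors. -/
theorem sq_dvd_mirrored_factors_sub (r : ℕ) (a b x : R) :
    (x - 1) ^ 2 ∣ (a * x ^ r - b) * (a - b * x) ^ r - (a - b) ^ (r + 1) * x ^ r := by
  obtain _ | r := r
  · simp
  obtain ⟨k₁, h₁⟩ := Polynomial.powAddExpansion (1 : R) (x - 1) (r + 1)
  obtain ⟨k₂, h₂⟩ := Polynomial.powAddExpansion (a - b) (-(b * (x - 1))) (r + 1)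
  have e₁ : (1 : R) + (x - 1) = x := by ring
  have e₂ : a - b + -(b * (x - 1)) = a - b * x := by ring
  rw [e₁] at h₁
  rw [e₂] at h₂
  simp only [Nat.add_sub_cancel, one_pow, mul_one] at h₁ h₂
  rw [h₁, h₂]
  push_cast
  refine ⟨a * k₁ * (a - b * x) ^ (r + 1) - a * b * (r + 1) ^ 2 * (a - b) ^ r
    + (a * (1 + (r + 1) * (x - 1)) - b) * k₂ * b ^ 2 - (a - b) ^ (r + 2) * k₁, ?_⟩
  rw [h₂]
  push_cast
  ring

theorem sq_dvd_numFactor_sub (r : ℕ) (q Q x : R) (i : ℕ) :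
    (x - 1) ^ 2 ∣ numFactor r q Q x i - numFactor r q Q 1 i * x ^ r := by
  convert sq_dvd_mirrored_factors_sub r q (Q ^ i) x using 1
  simp only [numFactor, one_pow, mul_one]
  ring

theorem sq_dvd_denFactor_sub (r : ℕ) (q Q x : R) (i : ℕ) :
    (x - 1) ^ 2 ∣ denFactor r q Q x i - denFactor r q Q 1 i * x ^ r := by
  convert dvd_zero _ using 1
  simp only [denFactor, one_pow, mul_one]
  ring

theorem sq_dvd_numFactor'_sub (r : ℕ) (q Q x : R) (i : ℕ) :
    (x - 1) ^ 2 ∣ numFactor' r q Q x i - numFactor' r q Q 1 i * x ^ r := by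
  convert (sq_dvd_mirrored_factors_sub r q (Q ^ i) x).mul_left (q - Q ^ i) using 1
  simp only [numFactor', one_pow, mul_one]
  ring

/-- Oddness of r makes the two sign changes, from reversing 1 - Q^(i+1) x^r and (x - Q^(i+1))^r,
cancel. -/
theorem sq_dvd_denFactor'_sub {r : ℕ} (hr : Odd r) (q Q x : R) (i : ℕ) :
    (x - 1) ^ 2 ∣ denFactor' r q Q x i - denFactor' r q Q 1 i * x ^ r := by
  convert (sq_dvd_mirrored_factors_sub r (Q ^ (i + 1)) 1 x).mul_left
    (q ^ (r + 2) * (1 - Q ^ (i + 1))) using 1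
  simp only [denFactor', one_pow, mul_one, one_mul]
  have e₁ : (Q ^ (i + 1) - x) ^ r = -(x - Q ^ (i + 1)) ^ r := by rw [← hr.neg_pow, neg_sub]
  have e₂ : (Q ^ (i + 1) - 1) ^ (r + 1) = (1 - Q ^ (i + 1)) ^ (r + 1) := by
    rw [← hr.add_one.neg_pow, neg_sub]
  rw [e₁, e₂]
  ring

/-- A solution `Z` of the first-order recurrence of the terms gives their closed form. -/
theorem wellPoisedSum_mul_eq (h M : ℕ) (q Q : R) (ν δ Z : ℕ → R)
    (hZ : ∀ k < M, Z (k + 1) * δ k = Z k * ν k) :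
    wellPoisedSum h M q Q ν δ * Z 0 =
      (∏ i ∈ range M, δ i) *
        ∑ k ∈ range (M + 1), (q - Q ^ (2 * k)) * Q ^ (h * k) * Z k := by
  have key : ∀ k ≤ M, (∏ i ∈ range k, ν i) * Z 0 = (∏ i ∈ range k, δ i) * Z k := by
    intro k hk
    induction k with
    | zero => simp
    | succ k ih =>
      rw [prod_range_succ, prod_range_succ, mul_assoc _ (δ k), mul_comm (δ k), hZ k hk,
        mul_right_comm, ih (by omega)]
      ring
  unfold wellPoisedSum
  rw [sum_mul, mul_sum]
  refine sum_congr rfl fun k hk ↦ ?_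
  have hk' : k ≤ M := Nat.lt_succ_iff.1 (mem_range.1 hk)
  rw [← prod_range_mul_prod_Ico δ hk']
  linear_combination (q - Q ^ (2 * k)) * Q ^ (h * k) * (∏ i ∈ Ico k M, δ i) * key k hk'

end General

/-! ### Exact vanishing at x = qⁿ by Lagrange interpolation -/

theorem sum_eval_div_prod_sub_eq_zero {K : Type*} [Field K] (v : ℕ → K) (N : ℕ)
    (hv : Set.InjOn v (range (N + 1) : Finset ℕ)) (P : Polynomial K) (hP : P.natDegree < N) :
    ∑ i ∈ range (N + 1), P.eval (v i) / ∏ j ∈ (range (N + 1)).erase i, (v i - v j) = 0 := by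
  rw [← Lagrange.coeff_eq_sum hv, card_range, Nat.add_sub_cancel]
  · exact Polynomial.coeff_eq_zero_of_natDegree_lt hP
  · rw [card_range]
    exact lt_of_le_of_lt Polynomial.degree_le_natDegree
      (by exact_mod_cast hP.trans (Nat.lt_succ_self N))

theorem prod_erase_eq_prod_ite {K : Type*} [CommMonoid K] (s : Finset ℕ) (k : ℕ) (f : ℕ → K) :
    ∏ j ∈ s.erase k, f j = ∏ j ∈ s, if j = k then 1 else f j := by
  rw [← prod_erase s (a := k) (by simp)]
  exact prod_congr rfl fun j hj ↦ by rw [if_neg (ne_of_mem_erase hj)]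

section ExactVanishing

variable {K : Type*} [Field K]

/-- Shifting j to j + 1 multiplies each difference of geometric nodes by x; only the end factors j =
0 and j = M + 1 remain unmatched. -/
theorem prod_erase_pow_sub_succ (x : K) {k M : ℕ} (hk : k < M + 1) :
    (∏ j ∈ (range (M + 2)).erase (k + 1), (x ^ (k + 1) - x ^ j)) * (x ^ k - x ^ (M + 1)) =
      (x ^ (k + 1) - 1) * x ^ M * ∏ j ∈ (range (M + 2)).erase k, (x ^ k - x ^ j) := by
  rw [prod_erase_eq_prod_ite, prod_erase_eq_prod_ite, prod_range_succ', prod_range_succ _ (M + 1),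
    if_neg (by omega : ¬ 0 = k + 1), if_neg (by omega : ¬ M + 1 = k)]
  have : ∏ j ∈ range (M + 1), (if j + 1 = k + 1 then 1 else x ^ (k + 1) - x ^ (j + 1)) =
      x ^ M * ∏ j ∈ range (M + 1), (if j = k then 1 else x ^ k - x ^ j) := by
    rw [← prod_erase_eq_prod_ite (range (M + 1)) k fun j ↦ x ^ k - x ^ j]
    simp only [Nat.add_right_cancel_iff]
    rw [← prod_erase_eq_prod_ite (range (M + 1)) k fun j ↦ x ^ (k + 1) - x ^ (j + 1)]
    have hc : ((range (M + 1)).erase k).card = M := by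
      rw [card_erase_of_mem (mem_range.2 hk), card_range, Nat.add_sub_cancel]
    conv_rhs => enter [1]; rw [← hc]
    rw [← prod_const, ← prod_mul_distrib]
    exact prod_congr rfl fun j _ ↦ by ring
  rw [this]
  ring

theorem wellPoisedSum_numFactor_eq_zero {q : K} (hq : ∀ a b : ℕ, q ^ a = q ^ b → a = b)
    (h m : ℕ) :
    wellPoisedSum (h + 1) ((2 * h + 2) * (m + 1) + 1) q (q ^ (2 * h + 3))
      (numFactor (2 * h + 2) q (q ^ (2 * h + 3)) (q ^ (1 + (2 * h + 3) * (m + 1))))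
      (denFactor (2 * h + 2) q (q ^ (2 * h + 3)) (q ^ (1 + (2 * h + 3) * (m + 1)))) = 0 := by
  have hq0 : q ≠ 0 := by
    rintro rfl
    simpa using hq 1 2 (by simp)
  obtain ⟨N, hN⟩ : ∃ N, N = (2 * h + 2) * (m + 1) := ⟨_, rfl⟩
  obtain ⟨n, hn⟩ : ∃ n, n = 1 + (2 * h + 3) * (m + 1) := ⟨_, rfl⟩
  obtain ⟨r, hr⟩ : ∃ r, r = 2 * h + 2 := ⟨_, rfl⟩
  obtain ⟨Q, hQ⟩ : ∃ Q, Q = q ^ (2 * h + 3) := ⟨_, rfl⟩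
  rw [← hN, ← hn, ← hr, ← hQ]
  have hQ0 : Q ≠ 0 := hQ ▸ pow_ne_zero _ hq0
  have hQinj : ∀ a b : ℕ, Q ^ a = Q ^ b → a = b := by
    intro a b hab
    rw [hQ, ← pow_mul, ← pow_mul] at hab
    exact Nat.eq_of_mul_eq_mul_left (by omega) (hq _ _ hab)
  have hqM : q * (q ^ n) ^ r = Q ^ (N + 1) := by
    rw [hQ, ← pow_mul, ← pow_mul, ← pow_succ']
    congr 1
    rw [hn, hr, hN]
    ring
  have hqn : q ^ n = q * Q ^ (m + 1) := by
    rw [hQ, ← pow_mul, ← pow_succ', hn, add_comm]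
  set W : ℕ → K := fun k ↦ ∏ j ∈ (range (N + 2)).erase k, (Q ^ k - Q ^ j) with hW
  -- G k / G 0 is the product over i < k of (1 - Q^(i+m+1)) / (1 - Q^(i+1)), a polynomial of degree
  -- m in Q^k.
  set G : ℕ → K := fun k ↦ ∏ j ∈ range m, (1 - Q ^ (j + 1) * Q ^ k) with hG
  have hW0 : ∀ k, W k ≠ 0 := fun k ↦ prod_ne_zero_iff.2 fun j hj hjk ↦
    ne_of_mem_erase hj (hQinj _ _ (sub_eq_zero.1 hjk)).symm
  have hGs : ∀ k, G (k + 1) * (1 - Q ^ (k + 1)) = G k * (1 - Q ^ k * Q ^ (m + 1)) := by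
    intro k
    have h₁ := prod_range_succ (fun j ↦ 1 - Q ^ (j + 1) * Q ^ k) m
    have h₂ := prod_range_succ' (fun j ↦ 1 - Q ^ (j + 1) * Q ^ k) m
    have h₃ : G (k + 1) = ∏ j ∈ range m, (1 - Q ^ (j + 1 + 1) * Q ^ k) :=
      prod_congr rfl fun j _ ↦ by ring
    rw [h₃]
    rw [h₁] at h₂
    simp only [hG]
    linear_combination -h₂
  have hrec := wellPoisedSum_mul_eq (h + 1) (N + 1) q Q (numFactor r q Q (q ^ n))
    (denFactor r q Q (q ^ n)) (fun k ↦ G k ^ r / (Q ^ k * W k)) ?_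
  · have hsum := sum_eval_div_prod_sub_eq_zero (fun k ↦ Q ^ k) (N + 1)
      (fun a _ b _ hab ↦ hQinj a b hab)
      -- The factor Q^k in the denominator of the closed form lowers Q^((h+1)k) to Q^(hk), hence
      -- X^h.
      ((Polynomial.C q - Polynomial.X ^ 2) * Polynomial.X ^ h *
        (∏ j ∈ range m, (1 - Polynomial.C (Q ^ (j + 1)) * Polynomial.X)) ^ r) ?_
    · have heq : ∑ k ∈ range (N + 1 + 1), (q - Q ^ (2 * k)) * Q ^ ((h + 1) * k) *
          (G k ^ r / (Q ^ k * W k)) = 0 := by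
        rw [← hsum]
        refine sum_congr rfl fun k _ ↦ ?_
        have := hW0 k
        simp only [Polynomial.eval_mul, Polynomial.eval_sub, Polynomial.eval_C,
          Polynomial.eval_pow, Polynomial.eval_X, Polynomial.eval_prod, Polynomial.eval_one]
        change _ = _ * G k ^ r / W k
        field_simp
        ring
      rw [heq, mul_zero] at hrec
      refine (mul_eq_zero.1 hrec).resolve_right (div_ne_zero (pow_ne_zero _ ?_) (by simp [hW0]))
      refine prod_ne_zero_iff.2 fun j _ hj ↦ ?_
      rw [pow_zero, mul_one, sub_eq_zero, ← pow_zero Q] at hj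
      exact absurd (hQinj _ _ hj) (by omega)
    · have h₁ : (∏ j ∈ range m, (1 - Polynomial.C (Q ^ (j + 1)) * Polynomial.X)).natDegree ≤ m := by
        refine (Polynomial.natDegree_prod_le _ _).trans ((sum_le_card_nsmul _ _ 1 ?_).trans ?_)
        · intro j _
          compute_degree
        · simp
      have h₂ : ((Polynomial.C q - Polynomial.X ^ 2) * Polynomial.X ^ h : Polynomial K).natDegree
          ≤ 2 + h := by compute_degree
      refine lt_of_le_of_lt (Polynomial.natDegree_mul_le_of_le h₂
        (Polynomial.natDegree_pow_le_of_le r h₁)) ?_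
      rw [hN, hr]
      nlinarith
  · intro k hk
    have hWs := prod_erase_pow_sub_succ Q hk
    change W (k + 1) * _ = _ * W k at hWs
    have hGr : G (k + 1) ^ r * (1 - Q ^ (k + 1)) ^ r = G k ^ r * (1 - Q ^ k * Q ^ (m + 1)) ^ r := by
      rw [← mul_pow, hGs, mul_pow]
    have hν : numFactor r q Q (q ^ n) k =
        (Q ^ (N + 1) - Q ^ k) * (q ^ r * (1 - Q ^ k * Q ^ (m + 1)) ^ r) := by
      rw [numFactor, hqM, hqn, ← mul_pow]
      ring
    have hδ : denFactor r q Q (q ^ n) k =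
        q ^ r * Q ^ (N + 1) * ((1 - Q ^ (k + 1)) ^ r * (1 - Q ^ (k + 1))) := by
      rw [denFactor, ← hqM]
      ring
    have h₀ := hW0 k
    have h₁ := hW0 (k + 1)
    rw [hν, hδ, div_mul_eq_mul_div, div_mul_eq_mul_div, div_eq_div_iff
      (mul_ne_zero (pow_ne_zero _ hQ0) h₁) (mul_ne_zero (pow_ne_zero _ hQ0) h₀)]
    linear_combination (q ^ r * Q ^ (N + 1) * (1 - Q ^ (k + 1)) * Q ^ k * W k) * hGr +
      (G k ^ r * q ^ r * (1 - Q ^ k * Q ^ (m + 1)) ^ r * Q ^ (k + 1)) * hWs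

theorem wellPoisedSum_numFactor'_eq_zero {q : K} (hq : ∀ a b : ℕ, q ^ a = q ^ b → a = b)
    {h g n N : ℕ} (hn : 2 * n = 1 + (2 * h + 3) * (2 * g + 1)) (hN : N + 1 + (2 * g + 1) = n) :
    wellPoisedSum (h + 1) (N + 1) q (q ^ (2 * h + 3))
      (numFactor' (2 * h + 1) q (q ^ (2 * h + 3)) (q ^ n))
      (denFactor' (2 * h + 1) q (q ^ (2 * h + 3)) (q ^ n)) = 0 := by
  have hq0 : q ≠ 0 := by
    rintro rfl
    simpa using hq 1 2 (by simp)
  obtain ⟨r, hr⟩ : ∃ r, r = 2 * h + 1 := ⟨_, rfl⟩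
  obtain ⟨Q, hQ⟩ : ∃ Q, Q = q ^ (2 * h + 3) := ⟨_, rfl⟩
  rw [← hr, ← hQ]
  have hQ0 : Q ≠ 0 := hQ ▸ pow_ne_zero _ hq0
  have hQinj : ∀ a b : ℕ, Q ^ a = Q ^ b → a = b := by
    intro a b hab
    rw [hQ, ← pow_mul, ← pow_mul] at hab
    exact Nat.eq_of_mul_eq_mul_left (by omega) (hq _ _ hab)
  have hqQ : ∀ a b : ℕ, Q ^ a * Q ^ b ≠ q := by
    intro a b hab
    rw [hQ, ← pow_mul, ← pow_mul, ← pow_add] at hab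
    have := hq _ 1 (by rw [hab, pow_one])
    rw [← mul_add] at this
    have := Nat.eq_one_of_mul_eq_one_right this
    omega
  have hqM : q * (q ^ n) ^ r = Q ^ (N + 1) := by
    rw [hQ, ← pow_mul, ← pow_mul, ← pow_succ']
    congr 1
    rw [hr]
    nlinarith
  have hqn : q ^ n * q ^ n = q * Q ^ (2 * g + 1) := by
    rw [hQ, ← pow_mul, ← pow_succ', ← pow_add]
    congr 1
    omega
  -- This balance of powers is where the exponent h + 1 of the sum is needed; it reduces to r + 2 =
  -- 2h + 3.
  have hqr : q ^ (r + 1) * Q ^ ((g + 1) * r) = (q ^ n) ^ r * Q ^ (h + 1) := by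
    rw [hQ, ← pow_mul, ← pow_mul, ← pow_mul, ← pow_add, ← pow_add]
    congr 1
    rw [hr]
    nlinarith
  have hqn0 : q ^ n ≠ 0 := pow_ne_zero _ hq0
  set W : ℕ → K := fun k ↦ ∏ j ∈ (range (N + 2)).erase k, (Q ^ k - Q ^ j) with hW
  set V : ℕ → K := fun k ↦ ∏ j ∈ range (N + 2), (1 - q / (Q ^ k * Q ^ j)) with hV
  -- With u = qⁿ / Q^(j+1), the factors of A and B multiply to (Q^k + q/Q^k) - (u + q/u), so A k * B
  -- k is a polynomial of degree g in the node.
  set A : ℕ → K := fun k ↦ ∏ j ∈ range g, (Q ^ k - q ^ n / Q ^ (j + 1)) with hA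
  set B : ℕ → K := fun k ↦ ∏ j ∈ range g, (1 - q * Q ^ (j + 1) / (q ^ n * Q ^ k)) with hB
  have hW0 : ∀ k, W k ≠ 0 := fun k ↦ prod_ne_zero_iff.2 fun j hj hjk ↦
    ne_of_mem_erase hj (hQinj _ _ (sub_eq_zero.1 hjk)).symm
  have hV1 : ∀ k j, 1 - q / (Q ^ k * Q ^ j) ≠ 0 := by
    intro k j hj
    rw [sub_eq_zero, eq_div_iff (by positivity), one_mul] at hj
    exact hqQ _ _ hj
  have hV0 : ∀ k, V k ≠ 0 := fun k ↦ prod_ne_zero_iff.2 fun j _ ↦ hV1 k j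
  have hQk : ∀ k, Q ^ k ≠ 0 := fun k ↦ pow_ne_zero _ hQ0
  have hc : ∀ k, Q ^ k * q ^ n - q * Q ^ g ≠ 0 := by
    intro k hk
    rw [sub_eq_zero, hQ, ← pow_mul, ← pow_mul, ← pow_succ', ← pow_add] at hk
    have h₁ := hq _ _ hk
    have h₂ : (2 * h + 3) * (2 * k + 1) = 1 := by nlinarith
    have := Nat.eq_one_of_mul_eq_one_right h₂
    omega
  have hAs : ∀ k, A (k + 1) * (Q ^ k - q ^ n / Q) =
      Q ^ g * A k * (Q ^ k - q ^ n / Q ^ (g + 1)) := by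
    intro k
    have h₁ := prod_range_succ (fun j ↦ Q ^ k - q ^ n / Q ^ (j + 1)) g
    have h₂ := prod_range_succ' (fun j ↦ Q ^ k - q ^ n / Q ^ (j + 1)) g
    have h₃ : A (k + 1) = Q ^ g * ∏ j ∈ range g, (Q ^ k - q ^ n / Q ^ (j + 1 + 1)) := by
      rw [show Q ^ g = ∏ _j ∈ range g, Q by simp, ← prod_mul_distrib]
      exact prod_congr rfl fun j _ ↦ by field_simp; ring
    rw [h₃]
    rw [h₁] at h₂
    rw [zero_add, pow_one] at h₂
    simp only [hA]
    linear_combination -Q ^ g * h₂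
  have hBs : ∀ k, B (k + 1) * (1 - q * Q ^ g / (q ^ n * Q ^ k)) =
      B k * (1 - q / (q ^ n * Q ^ k)) := by
    intro k
    have h₁ := prod_range_succ (fun j ↦ 1 - q * Q ^ j / (q ^ n * Q ^ k)) g
    have h₂ := prod_range_succ' (fun j ↦ 1 - q * Q ^ j / (q ^ n * Q ^ k)) g
    have h₃ : B (k + 1) = ∏ j ∈ range g, (1 - q * Q ^ j / (q ^ n * Q ^ k)) :=
      prod_congr rfl fun j _ ↦ by field_simp; ring
    rw [h₃]
    rw [h₁] at h₂
    rw [pow_zero, mul_one] at h₂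
    simpa only [hB] using h₂
  have hGs : ∀ k, q ^ n * (q ^ n - Q ^ (k + 1)) * (A (k + 1) * B (k + 1)) =
      Q ^ (g + 1) * (q - Q ^ k * q ^ n) * (A k * B k) := by
    intro k
    have h₁ := hAs k
    have h₂ := hBs k
    -- The surplus end factors of A and B agree up to a monomial, so they cancel in the product.
    have hroot : q ^ n / Q ^ (g + 1) = q * Q ^ g / q ^ n := by
      rw [div_eq_div_iff (hQk _) hqn0, hqn]
      ring
    rw [hroot] at h₁
    refine mul_right_cancel₀ (hc k) ?_
    have h₁' : A (k + 1) * (Q ^ (k + 1) - q ^ n) * q ^ n =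
        Q ^ (g + 1) * A k * (Q ^ k * q ^ n - q * Q ^ g) := by
      field_simp at h₁
      linear_combination h₁
    have h₂' : B (k + 1) * (Q ^ k * q ^ n - q * Q ^ g) = B k * (Q ^ k * q ^ n - q) := by
      have := hQk k
      field_simp at h₂
      linear_combination h₂
    linear_combination -(B (k + 1) * (Q ^ k * q ^ n - q * Q ^ g)) * h₁' -
      (Q ^ (g + 1) * A k * (Q ^ k * q ^ n - q * Q ^ g)) * h₂'
  have hVs : ∀ k, V (k + 1) * (Q ^ k - q) * Q ^ (N + 2) = V k * (Q ^ k * Q ^ (N + 2) - q) := by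
    intro k
    have h₁ := prod_range_succ (fun j ↦ 1 - q / (Q ^ k * Q ^ j)) (N + 2)
    have h₂ := prod_range_succ' (fun j ↦ 1 - q / (Q ^ k * Q ^ j)) (N + 2)
    have h₃ : V (k + 1) = ∏ j ∈ range (N + 2), (1 - q / (Q ^ k * Q ^ (j + 1))) :=
      prod_congr rfl fun j _ ↦ by rw [pow_succ Q k, pow_succ Q j]; ring
    rw [h₁, ← h₃, pow_zero, mul_one] at h₂
    change V k * _ = _ at h₂
    have := hQk k
    field_simp at h₂
    linear_combination -h₂
  have hrec := wellPoisedSum_mul_eq (h + 1) (N + 1) q Q (numFactor' r q Q (q ^ n))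
    (denFactor' r q Q (q ^ n))
    (fun k ↦ (A k * B k) ^ r / ((Q ^ k) ^ (h + 3) * W k * V k)) ?_
  · set v : ℕ → K := fun k ↦ Q ^ k + q / Q ^ k with hv
    have hvsub : ∀ k j, v k - v j = (Q ^ k - Q ^ j) * (1 - q / (Q ^ k * Q ^ j)) := by
      intro k j
      have h₁ := hQk k
      have h₂ := hQk j
      simp only [hv]
      field_simp
      ring
    have hsum := sum_eval_div_prod_sub_eq_zero v (N + 1) ?_
      ((∏ j ∈ range g, (Polynomial.X -
        Polynomial.C (q ^ n / Q ^ (j + 1) + q * Q ^ (j + 1) / q ^ n))) ^ r) ?_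
    · have heq : ∑ k ∈ range (N + 1 + 1), (q - Q ^ (2 * k)) * Q ^ ((h + 1) * k) *
          ((A k * B k) ^ r / ((Q ^ k) ^ (h + 3) * W k * V k)) = 0 := by
        rw [← neg_eq_zero, ← hsum, ← sum_neg_distrib]
        refine sum_congr rfl fun k hk ↦ ?_
        have hAB : Polynomial.eval (v k) (∏ j ∈ range g, (Polynomial.X -
            Polynomial.C (q ^ n / Q ^ (j + 1) + q * Q ^ (j + 1) / q ^ n))) = A k * B k := by
          rw [Polynomial.eval_prod, hA, hB, ← prod_mul_distrib]
          refine prod_congr rfl fun j _ ↦ ?_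
          have h₁ := hQk k
          have h₂ := hQk (j + 1)
          simp only [hv, Polynomial.eval_sub, Polynomial.eval_X, Polynomial.eval_C]
          field_simp
          ring
        have hVk := mul_prod_erase (range (N + 2)) (fun j ↦ 1 - q / (Q ^ k * Q ^ j)) hk
        change _ = V k at hVk
        rw [Polynomial.eval_pow, hAB]
        simp only [hvsub]
        rw [prod_mul_distrib]
        change _ = _ / (W k * _)
        rw [← hVk]
        have h₁ := hQk k
        have h₂ := hW0 k
        have h₃ := hV1 k k
        have h₄ : ∏ j ∈ (range (N + 2)).erase k, (1 - q / (Q ^ k * Q ^ j)) ≠ 0 :=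
          prod_ne_zero_iff.2 fun j _ ↦ hV1 k j
        -- The very-well-poised factor cancels the diagonal factor j = k of V, which the Lagrange
        -- weight omits.
        have h₅ : 1 - q / (Q ^ k * Q ^ k) = -(q - Q ^ (2 * k)) / (Q ^ k) ^ 2 := by
          field_simp
          ring
        have h₆ : q - Q ^ (2 * k) ≠ 0 := by
          intro h₆
          rw [h₅, h₆] at h₃
          simp at h₃
        rw [h₅]
        set P := ∏ j ∈ (range (N + 2)).erase k, (1 - q / (Q ^ k * Q ^ j))
        rw [show Q ^ ((h + 1) * k) = (Q ^ k) ^ (h + 1) by ring]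
        field_simp
        ring
      rw [heq, mul_zero] at hrec
      refine (mul_eq_zero.1 hrec).resolve_right (div_ne_zero (pow_ne_zero _ ?_)
        (mul_ne_zero (mul_ne_zero (pow_ne_zero _ (hQk 0)) (hW0 0)) (hV0 0)))
      have hdvd : ∀ a b : ℕ, (2 * h + 3) * a + 1 ≠ (2 * h + 3) * b := by
        intro a b hab
        have h₁ : 2 * h + 3 ∣ 1 := (Nat.dvd_add_right ⟨a, rfl⟩).1 ⟨b, hab⟩
        have := Nat.le_of_dvd one_pos h₁
        omega
      refine mul_ne_zero (prod_ne_zero_iff.2 fun j _ hj ↦ ?_)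
        (prod_ne_zero_iff.2 fun j _ hj ↦ ?_)
      · rw [pow_zero, sub_eq_zero, eq_div_iff (hQk _), one_mul, hQ, ← pow_mul] at hj
        exact hdvd (2 * g + 1) (2 * (j + 1)) (by linarith [hq _ _ hj])
      · rw [pow_zero, mul_one, sub_eq_zero, eq_div_iff hqn0, one_mul, hQ, ← pow_mul,
          ← pow_succ'] at hj
        exact hdvd (2 * (j + 1)) (2 * g + 1) (by linarith [hq _ _ hj])
    · intro a _ b _ hab
      have := hvsub a b
      rw [sub_eq_zero.2 hab, eq_comm, mul_eq_zero, or_iff_left (hV1 a b)] at this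
      exact hQinj _ _ (sub_eq_zero.1 this)
    · refine lt_of_le_of_lt (Polynomial.natDegree_pow_le_of_le r (m := g) ?_) ?_
      · rw [Polynomial.natDegree_finsetProd_X_sub_C_eq_card]
        simp
      · rw [hr]
        nlinarith
  · intro k hk
    have hWs := prod_erase_pow_sub_succ Q hk
    change W (k + 1) * _ = _ * W k at hWs
    have hGr : (q ^ n) ^ r * (q ^ n - Q ^ (k + 1)) ^ r * (A (k + 1) * B (k + 1)) ^ r =
      Q ^ ((g + 1) * r) * (q - Q ^ k * q ^ n) ^ r * (A k * B k) ^ r := by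
      rw [pow_mul, ← mul_pow, ← mul_pow, ← mul_pow, ← mul_pow, hGs]
    have hν : numFactor' r q Q (q ^ n) k =
        (q - Q ^ k) * ((Q ^ (N + 1) - Q ^ k) * (q - Q ^ k * q ^ n) ^ r) := by
      rw [numFactor', hqM]
    have hδ : denFactor' r q Q (q ^ n) k = q ^ (r + 1) * (1 - Q ^ (k + 1)) *
        ((q - Q ^ (k + 1) * Q ^ (N + 1)) * (q ^ n - Q ^ (k + 1)) ^ r) := by
      rw [denFactor', ← hqM]
      ring
    rw [hν, hδ, div_mul_eq_mul_div, div_mul_eq_mul_div, div_eq_div_iff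
      (mul_ne_zero (mul_ne_zero (pow_ne_zero _ (hQk _)) (hW0 _)) (hV0 _))
      (mul_ne_zero (mul_ne_zero (pow_ne_zero _ (hQk _)) (hW0 _)) (hV0 _))]
    refine mul_left_cancel₀ (mul_ne_zero (pow_ne_zero r hqn0) (hQk (N + 2))) ?_
    have hWV : (q - Q ^ k) * (Q ^ (N + 1) - Q ^ k) * (W (k + 1) * V (k + 1)) * Q ^ (N + 2) =
        (1 - Q ^ (k + 1)) * (q - Q ^ (k + 1) * Q ^ (N + 1)) * Q ^ N * (W k * V k) := by
      linear_combination (V (k + 1) * (Q ^ k - q) * Q ^ (N + 2)) * hWs +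
        ((Q ^ (k + 1) - 1) * Q ^ N * W k) * hVs k
    linear_combination (q ^ (r + 1) * (1 - Q ^ (k + 1)) * (q - Q ^ (k + 1) * Q ^ (N + 1)) *
        (Q ^ k) ^ (h + 3) * W k * V k * Q ^ (N + 2)) * hGr +
      ((1 - Q ^ (k + 1)) * (q - Q ^ (k + 1) * Q ^ (N + 1)) * (Q ^ k) ^ (h + 3) * W k * V k *
        Q ^ (N + 2) * (q - Q ^ k * q ^ n) ^ r * (A k * B k) ^ r) * hqr -
      ((q ^ n) ^ r * (A k * B k) ^ r * (q - Q ^ k * q ^ n) ^ r * (Q ^ (k + 1)) ^ (h + 3)) * hWV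

end ExactVanishing

/-! ### Reflection and cancellation at a root of unity -/

theorem numFactor'_mul_eq_neg {R : Type*} [CommRing R] {q Q x : R} {r M i : ℕ}
    (hr : Odd r) (hQM : Q ^ M = q) (hi : i < M) :
    numFactor' r q Q x i * q ^ (r + 2) =
      -(Q ^ (i * (r + 2)) * denFactor' r q Q x (M - 1 - i)) := by
  obtain ⟨b, hb⟩ : ∃ b, b = Q ^ (M - i) := ⟨_, rfl⟩
  have hqb : q = Q ^ i * b := by rw [← hQM, hb, ← pow_add]; congr 1; omega
  rw [numFactor', denFactor', show M - 1 - i + 1 = M - i by omega, ← hb, pow_mul]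
  have h₁ : q - Q ^ i * x = Q ^ i * -(x - b) := by rw [hqb]; ring
  have h₂ : q - Q ^ i = Q ^ i * -(1 - b) := by rw [hqb]; ring
  have h₃ : q * x ^ r - Q ^ i = Q ^ i * -(1 - b * x ^ r) := by rw [hqb]; ring
  rw [h₁, h₂, h₃, mul_pow, hr.neg_pow]
  ring

section RootOfUnity

variable {R : Type*} [CommRing R] [IsDomain R]

/-- At a root of unity the terms cancel in pairs `k ↔ M - k`. -/
theorem wellPoisedSum_numFactor'_eq_zero_of_pow_eq_one (h2 : (2 : R) ≠ 0) {q x : R} {h n M : ℕ}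
    (hq : q ^ n = 1) (hhalf : ∀ j, n = 2 * j → q ^ j = -1)
    (hM : (2 * h + 3) * M = (2 * h + 1) * n + 1)
    (hδ : ∀ i < M, denFactor' (2 * h + 1) q (q ^ (2 * h + 3)) x i ≠ 0) :
    wellPoisedSum (h + 1) M q (q ^ (2 * h + 3)) (numFactor' (2 * h + 1) q (q ^ (2 * h + 3)) x)
      (denFactor' (2 * h + 1) q (q ^ (2 * h + 3)) x) = 0 := by
  have hr : Odd (2 * h + 1) := ⟨h, rfl⟩
  have hpow : ∀ a, q ^ (a * n + 1) = q := fun a ↦ by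
    rw [pow_succ, mul_comm, mul_comm a, pow_mul, hq, one_pow, mul_one]
  have hq0 : q ≠ 0 := by
    rintro rfl
    obtain _ | n := n
    · have := hhalf 0 rfl
      rw [pow_zero] at this
      exact h2 (by linear_combination this)
    · simp at hq
  obtain ⟨Q, hQ⟩ : ∃ Q, Q = q ^ (2 * h + 3) := ⟨_, rfl⟩
  have hQM : Q ^ M = q := by rw [hQ, ← pow_mul, hM, hpow]
  have hQ0 : Q ≠ 0 := hQ ▸ pow_ne_zero _ hq0
  rw [← hQ] at hδ ⊢
  set ν := numFactor' (2 * h + 1) q Q x with hν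
  set δ := denFactor' (2 * h + 1) q Q x with hδ'
  obtain ⟨d, hd⟩ : ∃ d, d = 2 * h + 3 := ⟨_, rfl⟩
  have hrefl : ∀ i < M, ν i * q ^ d = -(Q ^ (i * d) * δ (M - 1 - i)) := fun i hi ↦
    hd ▸ numFactor'_mul_eq_neg hr hQM hi
  -- Y is symmetric under k ↦ M - k, whereas the remaining factor (q - Q^(2k)) Q^(-k) = Q^(M-k) -
  -- Q^k is antisymmetric.
  set Y : ℕ → R := fun k ↦ Q ^ ((h + 2) * k) * ((∏ i ∈ range k, ν i) * ∏ i ∈ Ico k M, δ i)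
    with hY
  have hYs : ∀ i < M, Y (i + 1) * δ i = Q ^ (h + 2) * Y i * ν i := by
    intro i hi
    simp only [hY]
    rw [prod_range_succ, prod_eq_prod_Ico_succ_bot hi]
    ring
  have hYr : ∀ i i', i + i' + 1 = M →
      Y (i + 1) * δ i * q ^ d = -(Q ^ (h + 2 + i * d) * Y i * δ i') := by
    intro i i' hi
    have h₁ := hrefl i (by omega)
    rw [show M - 1 - i = i' by omega] at h₁
    rw [hYs i (by omega)]
    linear_combination (Q ^ (h + 2) * Y i) * h₁
  have hsymm : ∀ s a b, a + b = M → b = a + s → Y a = Y b := by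
    intro s
    induction s using Nat.strong_induction_on with
    | _ s ih =>
      intro a b hab hs
      obtain _ | _ | s := s
      · rw [hs, add_zero]
      -- The middle pair occurs only for odd M, which forces n = 2j; then q^j = -1 supplies the
      -- sign.
      · have hs' : b = a + 1 := hs
        have h₁ := hYr a a (by omega)
        have h₂ : Q ^ (h + 2 + a * d) = -q ^ d := by
          have hM' : M = 2 * a + 1 := by omega
          obtain ⟨j, hj | hj⟩ := Nat.even_or_odd' n
          · have h₃ : h + 2 + a * d = (2 * h + 1) * j + 1 := by
              rw [hd]
              rw [hM', hj] at hM
              nlinarith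
            rw [h₃, hQ, ← pow_mul, show (2 * h + 3) * ((2 * h + 1) * j + 1) =
              j * ((2 * h + 1) * (2 * h + 3)) + (2 * h + 3) by ring, pow_add, pow_mul,
              hhalf j hj, hd, (hr.mul ⟨h + 1, by ring⟩).neg_one_pow]
            ring
          · exfalso
            rw [hM', hj] at hM
            have := congrArg (· % 2) hM
            ring_nf at this
            omega
        rw [h₂] at h₁
        rw [hs']
        refine (mul_right_cancel₀ (mul_ne_zero (hδ a (by omega)) (pow_ne_zero d hq0)) ?_).symm
        linear_combination h₁
      · obtain ⟨i', rfl⟩ : ∃ i', b = i' + 1 := ⟨b - 1, by omega⟩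
        have h₀ := ih s (by omega) (a + 1) i' (by omega) (by omega)
        have h₁ := hYr a i' (by omega)
        have h₂ := hYr i' a (by omega)
        rw [← h₀] at h₂
        -- The recurrences at the two ends a and i' combine, their monomial factors multiplying to
        -- q^(2d).
        have h₃ : Q ^ (h + 2 + a * d) * Q ^ (h + 2 + i' * d) = q ^ d * q ^ d := by
          rw [← pow_add, show h + 2 + a * d + (h + 2 + i' * d) = d * M + 1 by
            rw [← hab, hd]; ring, mul_comm, pow_succ, pow_mul, hQM, hQ, hd]
        refine (mul_right_cancel₀ (mul_ne_zero (hδ i' (by omega))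
          (mul_ne_zero (pow_ne_zero d hq0) (pow_ne_zero d hq0))) ?_).symm
        linear_combination q ^ d * h₂ - Q ^ (h + 2 + i' * d) * h₁ + (Y a * δ i') * h₃
  have hY' : ∀ k ≤ M, Y (M - k) = Y k := by
    intro k hk
    rcases le_total k (M - k) with hle | hle
    · exact (hsymm (M - k - k) k (M - k) (by omega) (by omega)).symm
    · exact hsymm (k - (M - k)) (M - k) k (by omega) (by omega)
  have hterm : ∀ k, (q - Q ^ (2 * k)) * Q ^ ((h + 1) * k) *
      ((∏ i ∈ range k, ν i) * ∏ i ∈ Ico k M, δ i) * Q ^ k = (q - Q ^ (2 * k)) * Y k := by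
    intro k
    simp only [hY]
    ring
  have hneg : wellPoisedSum (h + 1) M q Q ν δ = -wellPoisedSum (h + 1) M q Q ν δ := by
    conv_lhs => rw [wellPoisedSum, ← sum_range_reflect]
    rw [wellPoisedSum, ← sum_neg_distrib]
    refine sum_congr rfl fun k hk ↦ ?_
    have hk' : k ≤ M := Nat.lt_succ_iff.1 (mem_range.1 hk)
    rw [show M + 1 - 1 - k = M - k by omega]
    have h₁ := hterm (M - k)
    have h₂ := hterm k
    have h₃ : Q ^ (M - k) * Q ^ k = q := by rw [← pow_add, Nat.sub_add_cancel hk', hQM]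
    rw [hY' k hk', mul_comm 2, pow_mul Q (M - k)] at h₁
    rw [mul_comm 2, pow_mul Q k] at h₂
    rw [mul_comm 2 k, mul_comm 2 (M - k), pow_mul Q k, pow_mul Q (M - k)]
    generalize Q ^ (M - k) = u at *
    generalize hw : Q ^ k = w at *
    refine mul_right_cancel₀ hq0 ?_
    rw [← h₃] at h₁ h₂ ⊢
    linear_combination w * h₁ + u * h₂
  have : (2 : R) * wellPoisedSum (h + 1) M q Q ν δ = 0 := by linear_combination hneg
  exact (mul_eq_zero.1 this).resolve_left h2

end RootOfUnity

/-! ### From deformations to divisibility by powers of Φₙ -/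

section Congruence

open Polynomial

theorem cyclotomic_dvd_iff_aeval_eq_zero {n : ℕ} (hn : 0 < n) {ζ : ℂ} (hζ : IsPrimitiveRoot ζ n)
    (f : ℚ[X]) : cyclotomic n ℚ ∣ f ↔ aeval ζ f = 0 := by
  rw [cyclotomic_eq_minpoly_rat hζ hn, minpoly.dvd_iff]

theorem cyclotomic_pow_dvd_of_dvd_mul {n : ℕ} (hn : 0 < n) {ζ : ℂ} (hζ : IsPrimitiveRoot ζ n)
    {f g : ℚ[X]} (hg : aeval ζ g ≠ 0) (s : ℕ) (hfg : cyclotomic n ℚ ^ s ∣ f * g) :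
    cyclotomic n ℚ ^ s ∣ f :=
  (cyclotomic.irreducible_rat hn).prime.pow_dvd_of_dvd_mul_right s
    (fun h ↦ hg ((cyclotomic_dvd_iff_aeval_eq_zero hn hζ g).1 h)) hfg

theorem cyclotomic_dvd_X_pow_sub_one (n : ℕ) : cyclotomic n ℚ ∣ X ^ n - 1 :=
  cyclotomic.dvd_X_pow_sub_one n ℚ

/-- A deformation of `F` which is constant to first order at `1`, up to a power of the parameter,
and vanishes at `X ^ n`, shows that `F` is divisible by `Φₙ²`. -/
theorem cyclotomic_sq_dvd_of_deformation {n : ℕ} (hn : 0 < n) {F : ℚ[X]} {N : ℚ[X][X]} {k : ℕ}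
    (hdvd : (X - 1) ^ 2 ∣ N - C F * X ^ k) (hexact : N.eval (X ^ n) = 0) :
    cyclotomic n ℚ ^ 2 ∣ F := by
  have hζ := Complex.isPrimitiveRoot_exp n hn.ne'
  obtain ⟨E, hE⟩ := hdvd
  have h₁ := congrArg (eval (X ^ n)) hE
  simp only [eval_sub, eval_mul, eval_pow, eval_X, eval_C, eval_one, hexact, zero_sub] at h₁
  refine cyclotomic_pow_dvd_of_dvd_mul hn hζ (g := (X ^ n) ^ k) ?_ 2 ?_
  · simp [hζ.pow_eq_one]
  · rw [← dvd_neg, h₁]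
    exact (pow_dvd_pow_of_dvd (cyclotomic_dvd_X_pow_sub_one n) 2).mul_right _

/-- If moreover the deformation vanishes modulo `Φₙ`, then `F` is divisible by `Φₙ³`. -/
theorem cyclotomic_cube_dvd_of_deformation {n : ℕ} (hn : 0 < n) {ζ : ℂ}
    (hζ : IsPrimitiveRoot ζ n) {F : ℚ[X]} {N : ℚ[X][X]} {k : ℕ}
    (hdvd : (X - 1) ^ 2 ∣ N - C F * X ^ k) (hexact : N.eval (X ^ n) = 0)
    (hres : N.map (aeval ζ : ℚ[X] →ₐ[ℚ] ℂ).toRingHom = 0) :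
    cyclotomic n ℚ ^ 3 ∣ F := by
  obtain ⟨E, hE⟩ := hdvd
  have h₁ := congrArg (eval (X ^ n)) hE
  simp only [eval_sub, eval_mul, eval_pow, eval_X, eval_C, eval_one, hexact, zero_sub] at h₁
  have h₂ := congrArg (Polynomial.map (aeval ζ : ℚ[X] →ₐ[ℚ] ℂ).toRingHom) hE
  simp only [Polynomial.map_sub, Polynomial.map_mul, Polynomial.map_pow, map_X, map_C,
    Polynomial.map_one, hres, zero_sub] at h₂
  -- At x = 1 this leaves F(ζ) = 0, so (x - 1)² E vanishes over ℂ[x], and hence so does E.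
  have h₃ := congrArg (eval 1) h₂
  simp only [eval_neg, eval_mul, eval_sub, eval_pow, eval_X, eval_C, eval_one, one_pow, mul_one,
    sub_self, ne_eq, OfNat.ofNat_ne_zero, not_false_eq_true, zero_pow, zero_mul, neg_eq_zero] at h₃
  rw [h₃, C_0, zero_mul, neg_zero, eq_comm, mul_eq_zero] at h₂
  have hE0 := h₂.resolve_left (pow_ne_zero _ (X_sub_C_ne_zero (1 : ℂ)))
  have hdvdE : C (cyclotomic n ℚ) ∣ E := by
    rw [C_dvd_iff_dvd_coeff]
    intro i
    rw [cyclotomic_dvd_iff_aeval_eq_zero hn hζ]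
    have := congrArg (fun p ↦ coeff p i) hE0
    simpa using this
  obtain ⟨E', rfl⟩ := hdvdE
  refine cyclotomic_pow_dvd_of_dvd_mul hn hζ (g := (X ^ n) ^ k) ?_ 3 ?_
  · simp [hζ.pow_eq_one]
  · rw [← dvd_neg, h₁, eval_mul, eval_C, pow_succ _ 2]
    exact mul_dvd_mul (pow_dvd_pow_of_dvd (cyclotomic_dvd_X_pow_sub_one n) 2) (dvd_mul_right _ _)

end Congruence

/-! ### Application to the truncated sum -/

theorem coprime_of_two_mul_eq {n d m : ℕ} (hn : 2 * n = 1 + d * m) : Nat.Coprime n d := by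
  refine Nat.dvd_one.1 ((Nat.dvd_add_left ((Nat.gcd_dvd_right n d).mul_right m)).1 ?_)
  rw [← hn]
  exact (Nat.gcd_dvd_left n d).mul_left 2

section TruncatedSum

open Polynomial

/-- The truncated sum with `d = 2 * h + 3` and `n = L + 1`, cleared of denominators. -/
noncomputable def truncNum (h L : ℕ) : ℚ[X] :=
  wellPoisedSum (h + 1) L X (X ^ (2 * h + 3)) (fun i ↦ (X - (X ^ (2 * h + 3)) ^ i) ^ (2 * h + 3))
    (fun i ↦ X ^ (2 * h + 3) * (1 - (X ^ (2 * h + 3)) ^ (i + 1)) ^ (2 * h + 3))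

/-- The denominator cleared in `truncNum`. -/
noncomputable def truncDen (h L : ℕ) : ℚ[X] :=
  X * (1 - X) *
    ∏ i ∈ range L, X ^ (2 * h + 3) * (1 - (X ^ (2 * h + 3)) ^ (i + 1)) ^ (2 * h + 3)

theorem RatFunc.X_pow_injective {a b : ℕ} (h : (RatFunc.X : RatFunc ℚ) ^ a = RatFunc.X ^ b) :
    a = b := by
  rw [← RatFunc.algebraMap_X, ← map_pow, ← map_pow] at h
  have := congrArg natDegree (RatFunc.algebraMap_injective ℚ h)
  simpa using this

theorem truncSum_eq (h L : ℕ) :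
    truncSum (2 * h + 3) (L + 1) =
      algebraMap ℚ[X] (RatFunc ℚ) (truncNum h L) / algebraMap ℚ[X] (RatFunc ℚ) (truncDen h L) := by
  obtain ⟨x, hx⟩ : ∃ x : RatFunc ℚ, x = RatFunc.X := ⟨_, rfl⟩
  have hinj : ∀ a b : ℕ, x ^ a = x ^ b → a = b := fun a b hab ↦
    RatFunc.X_pow_injective (hx ▸ hab)
  have hx0 : x ≠ 0 := hx ▸ RatFunc.X_ne_zero
  have hx1 : 1 - x ≠ 0 := fun hx' ↦ by
    simpa using hinj 1 0 (by rw [pow_one, pow_zero, sub_eq_zero.1 hx'])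
  obtain ⟨Q, hQ⟩ : ∃ Q, Q = x ^ (2 * h + 3) := ⟨_, rfl⟩
  have hQ1 : ∀ i, 1 - Q ^ (i + 1) ≠ 0 := fun i hi ↦ by
    rw [sub_eq_zero, hQ, ← pow_mul, ← pow_zero x] at hi
    simpa using hinj _ _ hi
  set ν : ℕ → RatFunc ℚ := fun i ↦ (x - Q ^ i) ^ (2 * h + 3) with hν
  set δ : ℕ → RatFunc ℚ := fun i ↦ x ^ (2 * h + 3) * (1 - Q ^ (i + 1)) ^ (2 * h + 3) with hδ
  have hδ0 : ∀ i, δ i ≠ 0 := fun i ↦ mul_ne_zero (pow_ne_zero _ hx0) (pow_ne_zero _ (hQ1 i))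
  have hnum : algebraMap ℚ[X] (RatFunc ℚ) (truncNum h L) = wellPoisedSum (h + 1) L x Q ν δ := by
    rw [truncNum, map_wellPoisedSum]
    simp only [map_pow, map_sub, map_mul, map_one, RatFunc.algebraMap_X, ← hx, ← hQ, hν, hδ]
  have hden : algebraMap ℚ[X] (RatFunc ℚ) (truncDen h L) =
      x * (1 - x) * ∏ i ∈ range L, δ i := by
    rw [truncDen, map_mul, map_prod]
    simp only [map_pow, map_sub, map_mul, map_one, RatFunc.algebraMap_X, ← hx, ← hQ, hδ]
  have hP : ∏ i ∈ range L, δ i ≠ 0 := prod_ne_zero_iff.2 fun i _ ↦ hδ0 i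
  rw [hnum, hden, eq_div_iff (mul_ne_zero (mul_ne_zero hx0 hx1) hP), truncSum, wellPoisedSum,
    sum_mul]
  refine sum_congr rfl fun k hk ↦ ?_
  have hk' : k ≤ L := Nat.lt_succ_iff.1 (mem_range.1 hk)
  have hexp : (2 * h + 3) * (2 * h + 3 - 1) * k / 2 = (2 * h + 3) * ((h + 1) * k) := by
    rw [show 2 * h + 3 - 1 = 2 * (h + 1) by omega]
    exact Nat.div_eq_of_eq_mul_right two_pos (by ring)
  have hqint : qInt (2 * ((2 * h + 3 : ℕ) : ℤ) * (k : ℤ) - 1) * (x * (1 - x)) =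
      x - Q ^ (2 * k) := by
    rw [qInt, ← hx, zpow_sub_one₀ hx0, show 2 * ((2 * h + 3 : ℕ) : ℤ) * (k : ℤ) =
      (((2 * h + 3) * (2 * k) : ℕ) : ℤ) by push_cast; ring, zpow_natCast, pow_mul, ← hQ]
    field_simp
  have hpoch : qPoch x⁻¹ Q k ^ (2 * h + 3) / qPoch Q Q k ^ (2 * h + 3) *
      ∏ i ∈ range k, δ i = ∏ i ∈ range k, ν i := by
    rw [qPoch, qPoch, ← prod_pow, ← prod_pow, ← prod_div_distrib, ← prod_mul_distrib]
    refine prod_congr rfl fun i _ ↦ ?_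
    have h₁ := hQ1 i
    have h₂ : 1 - x⁻¹ * Q ^ i = (x - Q ^ i) / x := by field_simp
    simp only [hν, hδ]
    rw [h₂, ← pow_succ', div_pow]
    field_simp
  rw [hexp, ← hx, pow_mul x, ← hQ, ← prod_range_mul_prod_Ico δ hk', ← hqint, ← hpoch]
  ring

theorem ratCongr_truncSum_of_dvd {h L s : ℕ} (hL : 0 < L)
    (hcop : Nat.Coprime (L + 1) (2 * h + 3)) (hdvd : cyclotomic (L + 1) ℚ ^ s ∣ truncNum h L) :
    RatCongr (cyclotomic (L + 1) ℚ ^ s) (truncSum (2 * h + 3) (L + 1)) 0 := by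
  have hζ := Complex.isPrimitiveRoot_exp (L + 1) L.succ_ne_zero
  set ζ := Complex.exp (2 * Real.pi * Complex.I / (L + 1 : ℕ))
  have hζ0 : ζ ≠ 0 := hζ.ne_zero L.succ_ne_zero
  have hden : aeval ζ (truncDen h L) ≠ 0 := by
    simp only [truncDen, map_mul, map_sub, map_pow, map_one, aeval_X, map_prod]
    refine mul_ne_zero (mul_ne_zero hζ0 (sub_ne_zero.2 (hζ.ne_one (by omega)).symm))
      (prod_ne_zero_iff.2 fun i hi ↦ mul_ne_zero (pow_ne_zero _ hζ0) (pow_ne_zero _ ?_))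
    rw [← pow_mul, sub_ne_zero]
    intro h₁
    have h₂ := Nat.le_of_dvd i.succ_pos
      (hcop.dvd_of_dvd_mul_left ((hζ.pow_eq_one_iff_dvd _).1 h₁.symm))
    have := mem_range.1 hi
    omega
  have hden0 : truncDen h L ≠ 0 := fun h₀ ↦ hden (by rw [h₀, map_zero])
  rw [RatCongr, sub_zero]
  refine cyclotomic_pow_dvd_of_dvd_mul L.succ_pos hζ hden s ?_
  rw [(RatFunc.num_mul_eq_mul_denom_iff hden0).2 (truncSum_eq h L)]
  exact hdvd.mul_right _

theorem cyclotomic_sq_dvd_truncNum {h L m : ℕ} (hL : L = (2 * h + 3) * (m + 1)) :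
    cyclotomic (L + 1) ℚ ^ 2 ∣ truncNum h L := by
  refine cyclotomic_sq_dvd_of_deformation L.succ_pos (k := (2 * h + 2) * L)
    (N := wellPoisedSum (h + 1) L (C X) ((C X) ^ (2 * h + 3))
      (numFactor (2 * h + 2) (C X) ((C X) ^ (2 * h + 3)) X)
      (denFactor (2 * h + 2) (C X) ((C X) ^ (2 * h + 3)) X)) ?_ ?_
  · rw [pow_mul, truncNum, map_wellPoisedSum, map_pow]
    refine dvd_wellPoisedSum_sub _ _ _ _ _ _ _ _ _ _ (fun i ↦ ?_) (fun i ↦ ?_)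
    · convert sq_dvd_numFactor_sub (2 * h + 2) (C (X : ℚ[X])) ((C X) ^ (2 * h + 3)) X i using 3
      simp [numFactor, ← pow_succ']
    · convert sq_dvd_denFactor_sub (2 * h + 2) (C (X : ℚ[X])) ((C X) ^ (2 * h + 3)) X i using 3
      simp [denFactor]
  · rw [← coe_evalRingHom, map_wellPoisedSum]
    simp only [map_numFactor, map_denFactor, map_pow, coe_evalRingHom, eval_C, eval_X]
    have hexp : X * ((X : ℚ[X]) ^ (L + 1)) ^ (2 * h + 2) =
        (X ^ (2 * h + 3)) ^ ((2 * h + 2) * (m + 1) + 1) := by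
      rw [← pow_mul, ← pow_mul, ← pow_succ', hL]
      congr 1
      ring
    rw [wellPoisedSum_of_num_eq_zero (M := (2 * h + 2) * (m + 1) + 1) _ (by rw [hL]; nlinarith) _ _
      _ _ (by rw [numFactor, hexp, sub_self, zero_mul])]
    refine mul_eq_zero_of_left (RatFunc.algebraMap_injective ℚ ?_) _
    rw [map_wellPoisedSum, map_zero]
    simp only [map_numFactor, map_denFactor, map_pow, RatFunc.algebraMap_X]
    rw [hL, show ((2 * h + 3) * (m + 1)).succ = 1 + (2 * h + 3) * (m + 1) from Nat.add_comm _ 1]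
    exact wellPoisedSum_numFactor_eq_zero (fun _ _ ↦ RatFunc.X_pow_injective) h m

theorem cyclotomic_cube_dvd_truncNum {h L g : ℕ}
    (hL : 2 * (L + 1) = 1 + (2 * h + 3) * (2 * g + 1)) :
    cyclotomic (L + 1) ℚ ^ 3 ∣ truncNum h L := by
  have hodd : Odd (2 * h + 1) := ⟨h, rfl⟩
  have hζ := Complex.isPrimitiveRoot_exp (L + 1) L.succ_ne_zero
  set ζ := Complex.exp (2 * Real.pi * Complex.I / (L + 1 : ℕ))
  have hζ0 : ζ ≠ 0 := hζ.ne_zero L.succ_ne_zero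
  obtain ⟨N, hN⟩ : ∃ N, N + 1 + (2 * g + 1) = L + 1 := ⟨L - (2 * g + 1), by
    have : 2 * g + 1 ≤ L := by nlinarith
    omega⟩
  have hM : (2 * h + 3) * (N + 1) = (2 * h + 1) * (L + 1) + 1 := by nlinarith
  have hcop := coprime_of_two_mul_eq hL
  refine cyclotomic_cube_dvd_of_deformation L.succ_pos hζ (k := (2 * h + 1) * L)
    (N := wellPoisedSum (h + 1) L (C X) ((C X) ^ (2 * h + 3))
      (numFactor' (2 * h + 1) (C X) ((C X) ^ (2 * h + 3)) X)
      (denFactor' (2 * h + 1) (C X) ((C X) ^ (2 * h + 3)) X)) ?_ ?_ ?_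
  · rw [pow_mul, truncNum, map_wellPoisedSum, map_pow]
    refine dvd_wellPoisedSum_sub _ _ _ _ _ _ _ _ _ _ (fun i ↦ ?_) (fun i ↦ ?_)
    · convert sq_dvd_numFactor'_sub (2 * h + 1) (C (X : ℚ[X])) ((C X) ^ (2 * h + 3)) X i using 3
      simp [numFactor', ← pow_succ']
    · convert sq_dvd_denFactor'_sub hodd (C (X : ℚ[X])) ((C X) ^ (2 * h + 3)) X i using 3
      simp [denFactor']
      ring
  · rw [← coe_evalRingHom, map_wellPoisedSum]
    simp only [map_numFactor', map_denFactor', map_pow, coe_evalRingHom, eval_C, eval_X]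
    have hexp : X * ((X : ℚ[X]) ^ (L + 1)) ^ (2 * h + 1) = (X ^ (2 * h + 3)) ^ (N + 1) := by
      rw [← pow_mul, ← pow_mul, ← pow_succ', hM, mul_comm]
    rw [wellPoisedSum_of_num_eq_zero (M := N + 1) _ (by omega) _ _
      _ _ (by rw [numFactor', hexp, sub_self, zero_mul, mul_zero])]
    refine mul_eq_zero_of_left (RatFunc.algebraMap_injective ℚ ?_) _
    rw [map_wellPoisedSum, map_zero]
    simp only [map_numFactor', map_denFactor', map_pow, RatFunc.algebraMap_X]
    exact wellPoisedSum_numFactor'_eq_zero (fun _ _ ↦ RatFunc.X_pow_injective) hL hN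
  · rw [← coe_mapRingHom, map_wellPoisedSum]
    simp only [map_numFactor', map_denFactor', map_pow, coe_mapRingHom, map_C, map_X,
      AlgHom.toRingHom_eq_coe, RingHom.coe_coe, aeval_X]
    have hQM : (C ζ ^ (2 * h + 3)) ^ (N + 1) = C ζ := by
      rw [← pow_mul, hM, ← C_pow, pow_succ, mul_comm (2 * h + 1), pow_mul, hζ.pow_eq_one, one_pow,
        one_mul]
    rw [wellPoisedSum_of_num_eq_zero (M := N + 1) _ (by omega) _ _
      _ _ (by rw [numFactor', hQM, sub_self, zero_mul])]
    refine mul_eq_zero_of_left (wellPoisedSum_numFactor'_eq_zero_of_pow_eq_one two_ne_zero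
      (n := L + 1) ?_ ?_ hM ?_) _
    · rw [← C_pow, hζ.pow_eq_one, C_1]
    · intro j hj
      have h₁ : (ζ ^ j - 1) * (ζ ^ j + 1) = 0 := by
        have := hζ.pow_eq_one
        rw [hj, mul_comm 2, pow_mul] at this
        linear_combination this
      have h₂ : ζ ^ j - 1 ≠ 0 := sub_ne_zero.2 (hζ.pow_ne_one_of_pos_of_lt (by omega) (by omega))
      rw [← C_pow, eq_neg_of_add_eq_zero_left ((mul_eq_zero.1 h₁).resolve_left h₂), C_neg, C_1]
    · intro i hi
      have h₁ : 1 - (ζ ^ (2 * h + 3)) ^ (i + 1) ≠ 0 := by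
        rw [← pow_mul, sub_ne_zero]
        intro h₁
        have h₂ := Nat.le_of_dvd i.succ_pos
          (hcop.dvd_of_dvd_mul_left ((hζ.pow_eq_one_iff_dvd _).1 h₁.symm))
        omega
      rw [denFactor']
      refine mul_ne_zero (mul_ne_zero (pow_ne_zero _ (C_ne_zero.2 hζ0)) ?_)
        (mul_ne_zero ?_ (pow_ne_zero _ ?_))
      · rw [← C_pow, ← C_pow, ← C_1, ← C_sub]
        exact C_ne_zero.2 h₁
      -- The factor 1 - Q^(i+1) x^r takes the value 1 at x = 0, so it is a nonzero polynomial in x.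
      · intro h₂
        have := congrArg (eval 0) h₂
        simp at this
      · rw [← C_pow, ← C_pow]
        exact X_sub_C_ne_zero _

end TruncatedSum

theorem theorem1p2 (d n : ℕ) (hd : 3 ≤ d) (hodd : Odd d) (hn : 1 < n) :
    (n ≡ 1 [MOD d] →
      RatCongr (Polynomial.cyclotomic n ℚ ^ 2) (truncSum d n) 0) ∧
    (2 * n ≡ 1 [MOD d] →
      RatCongr (Polynomial.cyclotomic n ℚ ^ 3) (truncSum d n) 0) := by
  obtain ⟨h, rfl⟩ : ∃ h, d = 2 * h + 3 := by
    obtain ⟨c, rfl⟩ := hodd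
    exact ⟨c - 1, by omega⟩
  obtain ⟨L, rfl⟩ : ∃ L, n = L + 1 := ⟨n - 1, by omega⟩
  constructor
  · intro hmod
    obtain ⟨m, hm⟩ := (Nat.modEq_iff_dvd' hn.le).1 hmod.symm
    rw [Nat.add_sub_cancel] at hm
    obtain ⟨m, rfl⟩ : ∃ m', m = m' + 1 := ⟨m - 1, by
      have : m ≠ 0 := by rintro rfl; omega
      omega⟩
    refine ratCongr_truncSum_of_dvd (by omega) ?_ (cyclotomic_sq_dvd_truncNum hm)
    rw [hm]
    simp
  · intro hmod
    obtain ⟨m, hm⟩ := (Nat.modEq_iff_dvd' (by omega)).1 hmod.symm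
    obtain ⟨g, rfl | rfl⟩ := Nat.even_or_odd' m
    -- An even quotient is impossible, since 2n - 1 is odd.
    · rw [mul_left_comm] at hm
      omega
    · have hL : 2 * (L + 1) = 1 + (2 * h + 3) * (2 * g + 1) := by omega
      exact ratCongr_truncSum_of_dvd (by omega) (coprime_of_two_mul_eq hL)
        (cyclotomic_cube_dvd_truncNum hL)
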